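/- There are absolute constants $c_1,c_2>0$ such that the following holds for all positive integers $k$ and $d$ with $k\le d/4$. There are integers $d_1,d_2\le d$ and matrices $W_1\in\mathbb R^{d_1\times(k+1)}$, $W_2\in\mathbb R^{d_2\times d_1}$, $W_3\in\mathbb R^{d\times d_2}$ such that the three-layer ReLU network without offsets $$G:\mathbb R^{k+1}\to\mathbb R^d,\qquad G(x)=\sigma(W_3\,\sigma(W_2\,\sigma(W_1x))),\qquad \sigma(t)=\max\{t,0\}\ \text{entrywise},$$ has the following property. Let $K=G(\mathbb R^{k+1})\cap\mathbb B_2^d(1)$, where $\mathbb B_2^d(1)$ is the closed Euclidean unit ball. For every integer $m\ge c_1k\log(d/k)$, $$\inf_{\widehat\theta}\ \sup_{\theta_0\in K}\ \mathbb E\,\|\widehat\theta-\theta_0\|_2\ \ge\ c_2\sqrt{\frac{k\log(d/k)}{m}},$$ where the infimum is over all (possibly randomized) estimators $\widehat\theta$ that depend only on $m$ i.i.d. copies $(a_i,\check y_i)_{i=1}^m$ of $(a,\check y)$, with $\check y=\langle a,\theta_0\rangle+\xi$ and with $a\sim\mathcal N(0,\mathbf I_d)$ and $\xi\sim\mathcal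 N(0,1)$ independent. -/

import Mathlib

open MeasureTheory ProbabilityTheory
open scoped ENNReal

noncomputable section

/-- `ReLUNetwork p n d` is the type of weights of an `n`-layer offset-free ReLU network with
input dimension `p` and output dimension `d`; the layer widths are arbitrary. -/
inductive ReLUNetwork (p : ℕ) : ℕ → ℕ → Type
  | input : ReLUNetwork p 0 p
  | layer {n q d : ℕ} (N : ReLUNetwork p n q) (W : Matrix (Fin d) (Fin q) ℝ) :
      ReLUNetwork p (n + 1) d

namespace ReLUNetwork

/-- The function `x ↦ σ(Wₙ σ(Wₙ₋₁ ⋯ σ(W₁ x)))` computed by a network, where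
`σ(t) = max t 0` acts entrywise. -/
def eval {p : ℕ} : {n d : ℕ} → ReLUNetwork p n d →
    EuclideanSpace ℝ (Fin p) → EuclideanSpace ℝ (Fin d)
  | _, _, input, x => x
  | _, _, layer N W, x => WithLp.toLp 2 (fun i => max (W.mulVec (N.eval x).ofLp i) 0)

/-- Every layer after the input has at most `B` nodes. -/
def WidthLE (B : ℕ) {p : ℕ} : {n d : ℕ} → ReLUNetwork p n d → Prop
  | _, _, input => True
  | _, d, layer N _ => d ≤ B ∧ N.WidthLE B

/-- The set of vectors of Euclidean norm at most `1` in the range of the network. -/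
def unitBallRange {p n d : ℕ} (G : ReLUNetwork p n d) : Set (EuclideanSpace ℝ (Fin d)) :=
  Set.range G.eval ∩ Metric.closedBall 0 1

end ReLUNetwork

/-- The law of one observation `(a, ⟨a, θ₀⟩ + ξ)`, with `a ∼ N(0, I_d)` and `ξ ∼ N(0, 1)`
independent. -/
def linearModelLaw {d : ℕ} (θ₀ : EuclideanSpace ℝ (Fin d)) :
    Measure (EuclideanSpace ℝ (Fin d) × ℝ) :=
  ((stdGaussian (EuclideanSpace ℝ (Fin d))).prod (gaussianReal 0 1)).map
    (fun z => (z.1, inner ℝ z.1 θ₀ + z.2))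

/-- The law of `m` independent observations from the linear model. -/
def sampleLaw {d : ℕ} (m : ℕ) (θ₀ : EuclideanSpace ℝ (Fin d)) :
    Measure (Fin m → EuclideanSpace ℝ (Fin d) × ℝ) :=
  Measure.pi (fun _ => linearModelLaw θ₀)

instance {d : ℕ} (θ₀ : EuclideanSpace ℝ (Fin d)) : IsProbabilityMeasure (linearModelLaw θ₀) :=
  Measure.isProbabilityMeasure_map (by fun_prop)

theorem measurable_sampleLaw {d : ℕ} (m : ℕ) :
    Measurable (sampleLaw m : EuclideanSpace ℝ (Fin d) → _) := by
  have h : (sampleLaw m : EuclideanSpace ℝ (Fin d) → _) = fun θ₀ =>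
      (Measure.pi (fun _ : Fin m =>
        (stdGaussian (EuclideanSpace ℝ (Fin d))).prod (gaussianReal 0 1))).map
        (fun z i => ((z i).1, inner ℝ (z i).1 θ₀ + (z i).2)) := by
    funext θ₀
    have (_ : Fin m) : SigmaFinite (((stdGaussian (EuclideanSpace ℝ (Fin d))).prod
        (gaussianReal 0 1)).map (fun z => (z.1, inner ℝ z.1 θ₀ + z.2))) :=
      inferInstanceAs (SigmaFinite (linearModelLaw θ₀))
    exact (Measure.pi_map_pi (fun _ => by fun_prop)).symm
  rw [h]
  refine Measure.measurable_of_measurable_coe _ fun s hs => ?_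
  have hf : Measurable (fun p : EuclideanSpace ℝ (Fin d) ×
      (Fin m → EuclideanSpace ℝ (Fin d) × ℝ) => fun i =>
        ((p.2 i).1, inner ℝ (p.2 i).1 p.1 + (p.2 i).2)) := by fun_prop
  have hm := measurable_measure_prodMk_left (ν := Measure.pi (fun _ : Fin m =>
        (stdGaussian (EuclideanSpace ℝ (Fin d))).prod (gaussianReal 0 1))) (hf hs)
  convert hm using 2 with θ₀
  rw [Measure.map_apply (by fun_prop) hs]
  rfl

/-- The statistical model: the law of the `m` observations as a function of the parameter,
which ranges over `K`. -/
def sampleKernel {d : ℕ} (m : ℕ) (K : Set (EuclideanSpace ℝ (Fin d))) :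
    Kernel K (Fin m → EuclideanSpace ℝ (Fin d) × ℝ) where
  toFun θ₀ := sampleLaw m (θ₀ : EuclideanSpace ℝ (Fin d))
  measurable' := (measurable_sampleLaw m).comp measurable_subtype_coe

/-- The minimax risk `inf_θ̂ sup_{θ₀ ∈ K} 𝔼 ‖θ̂ - θ₀‖₂` for estimation from `m` observations.
The infimum is over all (possibly randomized) estimators, that is, over all Markov kernels from
the sample space to `ℝ^d`; deterministic estimators are the Dirac kernels. -/
def linearMinimaxRisk {d : ℕ} (m : ℕ) (K : Set (EuclideanSpace ℝ (Fin d))) : ℝ≥0∞ :=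
  minimaxRisk
    (fun (θ₀ : K) (t : EuclideanSpace ℝ (Fin d)) =>
      ENNReal.ofReal ‖t - (θ₀ : EuclideanSpace ℝ (Fin d))‖)
    (sampleKernel m K)

end

/-!
The network is a bank of one-hot encoders. Split `k * N` output coordinates, where
`N = ⌊d / k⌋ - 2`, into `k` blocks of length `N`. The extra input coordinate `z` plays the role of
a bias: the first layer computes the hinges `σ(xᵢ - j z)`, and their second difference in `j` is a
tent function of `xᵢ` that vanishes at every integer multiple of `z` but one. So for every
`v : Fin k → Fin N` the range contains the signal with the value `z` at the `vᵢ`-th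
coordinate of the `i`-th block, and `0` elsewhere (`exists_reluNetwork_blockSignal_mem_range`).

The lower bound is an Assouad argument whose coordinates are `N`-ary instead of binary. Read an
estimate as a guess for each `vᵢ`. A wrong guess in `w` of the `k` blocks costs at least
`(z / 2) √w ≥ z w / (2 √k)` in norm (`sum_indicator_blockRegion_le_norm`), which is linear in `w`.
It therefore suffices that for uniformly random `v` each single block is misread with probability
at least `1 / 8`; no packing of the set of signals and no entropy inequality is needed.

For one block, the `N` candidates are compared with the signal in which this block is zero. Under a
shift of the parameter by `δ`, the likelihood ratio `Λ` satisfies `𝔼 Λ² ≤ exp (2 m ‖δ‖²)` by the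
Gaussian integral of `exp (⟨a, δ⟩²)` (`lintegral_sampleLikelihoodRatio_sq_le`). Cutting `Λ` off at
the level `3 N / 4` bounds the average success probability of `N` disjoint guesses by `7 / 8`, as
soon as `𝔼 Λ² ≤ (3 N + 4) / 8` (`sum_lintegral_sampleLaw_add_le`). The choice
`z² = log N / (8 m)` makes `𝔼 Λ² ≤ N ^ (1 / 4)`, so this holds; the sample size condition keeps the
signals in the unit ball, and `log N ≥ log (d / k) / 3` because `d / k ≥ 4`.
-/

/-! ### Products of densities and Gaussian integrals -/

theorem lintegral_pi_prod_eq_prod_lintegral {ι X : Type*} [Fintype ι] [MeasurableSpace X]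
    (μ : Measure X) [IsProbabilityMeasure μ] {f : ι → X → ℝ≥0∞} (hf : ∀ i, Measurable (f i)) :
    ∫⁻ x : ι → X, ∏ i, f i (x i) ∂Measure.pi (fun _ => μ) = ∏ i, ∫⁻ x, f i x ∂μ := by
  have h := iIndepFun_pi (μ := fun _ : ι => μ) (X := f) (fun i => (hf i).aemeasurable)
  rw [lintegral_prod_eq_prod_lintegral_of_indepFun Finset.univ _ h
    (fun i => (hf i).comp (measurable_pi_apply i))]
  refine Finset.prod_congr rfl fun i _ => ?_
  rw [← (measurePreserving_eval (fun _ : ι => μ) i).lintegral_comp (hf i)]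

theorem pi_withDensity_eq_withDensity_prod {ι X : Type*} [Fintype ι] [MeasurableSpace X]
    (μ : Measure X) [IsProbabilityMeasure μ] {f : X → ℝ≥0∞} (hf : Measurable f)
    [SigmaFinite (μ.withDensity f)] :
    Measure.pi (fun _ : ι => μ.withDensity f) =
      (Measure.pi fun _ => μ).withDensity (fun x => ∏ i, f (x i)) := by
  refine Measure.pi_eq fun s hs => ?_
  rw [withDensity_apply _ (.univ_pi hs), ← lintegral_indicator (.univ_pi hs)]
  have : (Set.univ.pi s).indicator (fun x => ∏ i, f (x i)) =
      fun x => ∏ i, (s i).indicator f (x i) := by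
    classical
    funext x
    by_cases hx : x ∈ Set.univ.pi s
    · rw [Set.indicator_of_mem hx]
      exact Finset.prod_congr rfl fun i _ =>
        (Set.indicator_of_mem (hx i (Set.mem_univ i)) _).symm
    · rw [Set.indicator_of_notMem hx]
      simp only [Set.mem_pi, Set.mem_univ, true_implies, not_forall] at hx
      obtain ⟨i, hi⟩ := hx
      exact (Finset.prod_eq_zero (Finset.mem_univ i) (Set.indicator_of_notMem hi _)).symm
  rw [this, lintegral_pi_prod_eq_prod_lintegral μ (fun i => hf.indicator (hs i))]
  refine Finset.prod_congr rfl fun i _ => ?_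
  rw [withDensity_apply _ (hs i), lintegral_indicator (hs i)]

/-- The one-dimensional Cameron–Martin formula. -/
theorem gaussianReal_eq_withDensity_exp (c : ℝ) :
    gaussianReal c 1 =
      (gaussianReal 0 1).withDensity fun y => ENNReal.ofReal (Real.exp (y * c - c ^ 2 / 2)) := by
  rw [gaussianReal_of_var_ne_zero _ one_ne_zero, gaussianReal_of_var_ne_zero _ one_ne_zero,
    ← withDensity_mul _ (measurable_gaussianPDF _ _) (by fun_prop)]
  congr 1
  funext y
  simp only [gaussianPDF, Pi.mul_apply]
  rw [← ENNReal.ofReal_mul (gaussianPDFReal_nonneg _ _ _)]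
  congr 1
  simp only [gaussianPDFReal, mul_assoc, ← Real.exp_add]
  congr 2
  simp
  ring

theorem map_inner_stdGaussian {d : ℕ} (δ : EuclideanSpace ℝ (Fin d)) :
    (stdGaussian (EuclideanSpace ℝ (Fin d))).map (fun a => inner ℝ a δ) =
      gaussianReal 0 (‖δ‖ ^ 2).toNNReal := by
  have h := IsGaussian.map_eq_gaussianReal (μ := stdGaussian (EuclideanSpace ℝ (Fin d)))
    (innerSL ℝ δ)
  rw [integral_strongDual_stdGaussian, variance_dual_stdGaussian] at h
  have h2 : (fun a => inner ℝ a δ) = (innerSL ℝ δ : EuclideanSpace ℝ (Fin d) → ℝ) := by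
    funext a; simp [real_inner_comm]
  rw [h2, h, innerSL_apply_norm]

/-- The exact value is `(1 - 2 v) ^ (-1 / 2)`. -/
theorem lintegral_exp_sq_gaussianReal_le {v : ℝ} (hv : 0 ≤ v) (hv4 : v ≤ 1 / 4) :
    ∫⁻ x, ENNReal.ofReal (Real.exp (x ^ 2)) ∂gaussianReal 0 v.toNNReal ≤
      ENNReal.ofReal (Real.exp (2 * v)) := by
  have hmap : gaussianReal 0 v.toNNReal = (gaussianReal 0 1).map (fun x => √v * x) := by
    rw [gaussianReal_map_const_mul]
    congr 1
    · simp
    · ext; simp [Real.sq_sqrt hv, Real.coe_toNNReal _ hv]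
  rw [hmap, lintegral_map (by fun_prop) (by fun_prop), gaussianReal_of_var_ne_zero _ one_ne_zero,
    lintegral_withDensity_eq_lintegral_mul _ (measurable_gaussianPDF _ _) (by fun_prop)]
  have hb : (0 : ℝ) < 1 / 2 - v := by linarith
  have hfun : ∀ x : ℝ, (gaussianPDF 0 1 * fun a => ENNReal.ofReal (Real.exp ((√v * a) ^ 2))) x =
      ENNReal.ofReal ((√(2 * Real.pi))⁻¹ * Real.exp (-(1 / 2 - v) * x ^ 2)) := by
    intro x
    simp only [gaussianPDF, Pi.mul_apply]
    rw [← ENNReal.ofReal_mul (gaussianPDFReal_nonneg _ _ _)]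
    congr 1
    simp only [gaussianPDFReal, mul_assoc, ← Real.exp_add, mul_pow, Real.sq_sqrt hv]
    congr 2 <;> simp
    ring
  simp_rw [hfun]
  rw [← ofReal_integral_eq_lintegral_ofReal ((integrable_exp_neg_mul_sq hb).const_mul _)
    (.of_forall fun x => by positivity), integral_const_mul, integral_gaussian]
  refine ENNReal.ofReal_le_ofReal ?_
  rw [← Real.sqrt_inv, ← Real.sqrt_mul (by positivity)]
  refine Real.sqrt_le_iff.2 ⟨by positivity, ?_⟩
  have h1 : (2 * Real.pi)⁻¹ * (Real.pi / (1 / 2 - v)) = (1 - 2 * v)⁻¹ := by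
    have : (1 : ℝ) - 2 * v ≠ 0 := by linarith
    have : (1 : ℝ) / 2 - v ≠ 0 := hb.ne'
    field_simp
  rw [h1, ← Real.exp_nat_mul, inv_le_iff_one_le_mul₀ (by linarith)]
  have h2 := Real.add_one_le_exp ((2 : ℕ) * (2 * v))
  push_cast at h2 ⊢
  nlinarith [mul_nonneg hv (sub_nonneg.2 hv4)]

/-! ### The likelihood ratio of the linear model -/

/-- The likelihood ratio of one observation `(a, y)`, for the parameter `δ` against the
parameter `0`. -/
noncomputable def likelihoodRatio {d : ℕ} (δ : EuclideanSpace ℝ (Fin d))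
    (z : EuclideanSpace ℝ (Fin d) × ℝ) : ℝ≥0∞ :=
  ENNReal.ofReal (Real.exp (z.2 * inner ℝ z.1 δ - (inner ℝ z.1 δ) ^ 2 / 2))

@[fun_prop]
theorem measurable_likelihoodRatio {d : ℕ} (δ : EuclideanSpace ℝ (Fin d)) :
    Measurable (likelihoodRatio δ) := by
  unfold likelihoodRatio; fun_prop

theorem linearModelLaw_zero {d : ℕ} :
    linearModelLaw (0 : EuclideanSpace ℝ (Fin d)) =
      (stdGaussian (EuclideanSpace ℝ (Fin d))).prod (gaussianReal 0 1) := by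
  simp [linearModelLaw]

theorem linearModelLaw_eq_withDensity {d : ℕ} (δ : EuclideanSpace ℝ (Fin d)) :
    linearModelLaw δ = (linearModelLaw 0).withDensity (likelihoodRatio δ) := by
  rw [linearModelLaw_zero]
  ext s hs
  rw [linearModelLaw, Measure.map_apply (by fun_prop) hs,
    Measure.prod_apply ((show Measurable _ by fun_prop) hs), withDensity_apply _ hs,
    ← lintegral_indicator hs, lintegral_prod _ (by fun_prop (disch := assumption))]
  refine lintegral_congr fun a => ?_
  have hsa : MeasurableSet (Prod.mk a ⁻¹' s) := measurable_prodMk_left hs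
  have h1 : gaussianReal 0 1 (Prod.mk a ⁻¹' ((fun z : EuclideanSpace ℝ (Fin d) × ℝ =>
      (z.1, inner ℝ z.1 δ + z.2)) ⁻¹' s)) = gaussianReal (inner ℝ a δ) 1 (Prod.mk a ⁻¹' s) := by
    have h := gaussianReal_map_const_add (μ := 0) (v := 1) (inner ℝ a δ)
    rw [zero_add] at h
    rw [← h, Measure.map_apply (by fun_prop) hsa]
    rfl
  rw [h1, gaussianReal_eq_withDensity_exp, withDensity_apply _ hsa, ← lintegral_indicator hsa]
  rfl

/-- Integrating out the response turns the square of the likelihood ratio into `exp (⟨a, δ⟩²)`. -/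
theorem lintegral_likelihoodRatio_sq_le {d : ℕ} {δ : EuclideanSpace ℝ (Fin d)}
    (hδ : ‖δ‖ ^ 2 ≤ 1 / 4) :
    ∫⁻ z, likelihoodRatio δ z ^ 2 ∂linearModelLaw 0 ≤ ENNReal.ofReal (Real.exp (2 * ‖δ‖ ^ 2)) := by
  rw [linearModelLaw_zero, lintegral_prod _ (by fun_prop)]
  have h1 : ∀ a : EuclideanSpace ℝ (Fin d),
      ∫⁻ y, likelihoodRatio δ (a, y) ^ 2 ∂gaussianReal 0 1 =
        ENNReal.ofReal (Real.exp ((inner ℝ a δ) ^ 2)) := by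
    intro a
    set c : ℝ := inner ℝ a δ with hc
    -- The square is, up to the factor `exp (c²)`, the density of the Gaussian with mean `2c`.
    have h2 : ∀ y, likelihoodRatio δ (a, y) ^ 2 = ENNReal.ofReal (Real.exp (c ^ 2)) *
        ENNReal.ofReal (Real.exp (y * (2 * c) - (2 * c) ^ 2 / 2)) := by
      intro y
      rw [likelihoodRatio, ← ENNReal.ofReal_pow (by positivity),
        ← ENNReal.ofReal_mul (by positivity), ← Real.exp_nat_mul, ← Real.exp_add, ← hc]
      congr 2
      push_cast
      ring
    simp_rw [h2]
    rw [lintegral_const_mul _ (by fun_prop), ← setLIntegral_univ,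
      ← withDensity_apply _ MeasurableSet.univ, ← gaussianReal_eq_withDensity_exp, measure_univ,
      mul_one]
  simp_rw [h1]
  rw [← lintegral_map (μ := stdGaussian (EuclideanSpace ℝ (Fin d)))
    (f := fun x : ℝ => ENNReal.ofReal (Real.exp (x ^ 2))) (g := fun a => inner ℝ a δ)
    (by fun_prop) (by fun_prop), map_inner_stdGaussian]
  exact lintegral_exp_sq_gaussianReal_le (by positivity) hδ

/-- The likelihood ratio of `m` independent observations, for the parameter `δ` against the
parameter `0`. -/
noncomputable def sampleLikelihoodRatio {d : ℕ} (m : ℕ) (δ : EuclideanSpace ℝ (Fin d))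
    (x : Fin m → EuclideanSpace ℝ (Fin d) × ℝ) : ℝ≥0∞ :=
  ∏ i, likelihoodRatio δ (x i)

@[fun_prop]
theorem measurable_sampleLikelihoodRatio {d : ℕ} (m : ℕ) (δ : EuclideanSpace ℝ (Fin d)) :
    Measurable (sampleLikelihoodRatio m δ) := by
  unfold sampleLikelihoodRatio; fun_prop

instance {d : ℕ} (m : ℕ) (θ : EuclideanSpace ℝ (Fin d)) :
    IsProbabilityMeasure (sampleLaw m θ) :=
  inferInstanceAs (IsProbabilityMeasure (Measure.pi _))

theorem sampleLaw_eq_withDensity {d : ℕ} (m : ℕ) (δ : EuclideanSpace ℝ (Fin d)) :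
    sampleLaw m δ = (sampleLaw m 0).withDensity (sampleLikelihoodRatio m δ) := by
  have : SigmaFinite
      ((linearModelLaw (0 : EuclideanSpace ℝ (Fin d))).withDensity (likelihoodRatio δ)) := by
    rw [← linearModelLaw_eq_withDensity]; infer_instance
  have h := pi_withDensity_eq_withDensity_prod (ι := Fin m)
    (linearModelLaw (0 : EuclideanSpace ℝ (Fin d))) (measurable_likelihoodRatio δ)
  rwa [← linearModelLaw_eq_withDensity] at h

theorem lintegral_sampleLikelihoodRatio_sq_le {d : ℕ} (m : ℕ) {δ : EuclideanSpace ℝ (Fin d)}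
    (hδ : ‖δ‖ ^ 2 ≤ 1 / 4) :
    ∫⁻ x, sampleLikelihoodRatio m δ x ^ 2 ∂sampleLaw m 0 ≤
      ENNReal.ofReal (Real.exp (2 * m * ‖δ‖ ^ 2)) := by
  simp only [sampleLikelihoodRatio, ← Finset.prod_pow]
  have h := lintegral_pi_prod_eq_prod_lintegral
    (linearModelLaw (0 : EuclideanSpace ℝ (Fin d)))
    (f := fun (_ : Fin m) z => likelihoodRatio δ z ^ 2) (fun _ => by fun_prop)
  rw [sampleLaw, h, Finset.prod_const, Finset.card_univ, Fintype.card_fin]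
  refine (pow_le_pow_left' (lintegral_likelihoodRatio_sq_le hδ) m).trans_eq ?_
  rw [← ENNReal.ofReal_pow (by positivity), ← Real.exp_nat_mul]
  congr 2
  ring

/-- The map `(a, y) ↦ (a, ⟨a, θ⟩ + y)` of observations. It adds `θ` to the parameter of the linear
model, which reduces changes of measure to a change from the parameter `0`. -/
noncomputable def shiftResponse {d : ℕ} (θ : EuclideanSpace ℝ (Fin d))
    (z : EuclideanSpace ℝ (Fin d) × ℝ) : EuclideanSpace ℝ (Fin d) × ℝ :=
  (z.1, inner ℝ z.1 θ + z.2)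

@[fun_prop]
theorem measurable_shiftResponse {d : ℕ} (θ : EuclideanSpace ℝ (Fin d)) :
    Measurable (shiftResponse θ) := by
  unfold shiftResponse; fun_prop

theorem sampleLaw_add_eq_map {d : ℕ} (m : ℕ) (θ δ : EuclideanSpace ℝ (Fin d)) :
    sampleLaw m (θ + δ) = (sampleLaw m δ).map (fun x i => shiftResponse θ (x i)) := by
  have h1 : linearModelLaw (θ + δ) = (linearModelLaw δ).map (shiftResponse θ) := by
    rw [linearModelLaw, linearModelLaw, Measure.map_map (by fun_prop) (by fun_prop)]
    congr 1
    funext z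
    simp [shiftResponse, inner_add_right, add_assoc]
  have (_ : Fin m) : SigmaFinite ((linearModelLaw δ).map (shiftResponse θ)) := by
    rw [← h1]; infer_instance
  rw [sampleLaw, sampleLaw, Measure.pi_map_pi (fun _ => by fun_prop), h1]

/-- Change of measure for a test function `0 ≤ g ≤ 1`. The likelihood ratio `Λ` exceeds the level
`c` by at most `(Λ - 1)² / (4 (c - 1))`, and `𝔼 (Λ - 1)² = 𝔼 Λ² - 1`. The inequality is multiplied
by `4 (c - 1)` to avoid the division. -/
theorem lintegral_sampleLaw_add_le_lintegral_sampleLaw {d m : ℕ} {θ δ : EuclideanSpace ℝ (Fin d)}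
    (hδ : ‖δ‖ ^ 2 ≤ 1 / 4) {g : (Fin m → EuclideanSpace ℝ (Fin d) × ℝ) → ℝ≥0∞}
    (hg : Measurable g) (hg1 : ∀ x, g x ≤ 1) {c : ℝ} (hc : 1 ≤ c) :
    4 * (c - 1) * (∫⁻ x, g x ∂sampleLaw m (θ + δ)).toReal + 1 ≤
      4 * (c - 1) * c * (∫⁻ x, g x ∂sampleLaw m θ).toReal + Real.exp (2 * m * ‖δ‖ ^ 2) := by
  set T : (Fin m → EuclideanSpace ℝ (Fin d) × ℝ) → (Fin m → EuclideanSpace ℝ (Fin d) × ℝ) :=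
    fun x i => shiftResponse θ (x i) with hT
  have hTm : Measurable T := by fun_prop
  set Λ := sampleLikelihoodRatio m δ with hΛ
  set P := sampleLaw m (0 : EuclideanSpace ℝ (Fin d)) with hP
  have hΛm : Measurable Λ := by fun_prop
  set h := fun x => g (T x) with hh
  have hhm : Measurable h := hg.comp hTm
  have e1 : ∫⁻ x, g x ∂sampleLaw m (θ + δ) = ∫⁻ x, h x * Λ x ∂P := by
    rw [sampleLaw_add_eq_map, lintegral_map hg hTm, sampleLaw_eq_withDensity,
      lintegral_withDensity_eq_lintegral_mul _ hΛm hhm]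
    simp [hh, mul_comm, Pi.mul_apply, ← hP]
  have e0 : ∫⁻ x, g x ∂sampleLaw m θ = ∫⁻ x, h x ∂P := by
    have := sampleLaw_add_eq_map m θ 0
    rw [add_zero] at this
    rw [this, lintegral_map hg hTm]
  have e2 : ∫⁻ x, Λ x ∂P = 1 := by
    rw [← setLIntegral_univ, ← withDensity_apply _ MeasurableSet.univ, ← sampleLaw_eq_withDensity,
      measure_univ]
  have e3 := lintegral_sampleLikelihoodRatio_sq_le m hδ
  have hΛtop : ∀ x, Λ x ≠ ∞ := fun x => by
    rw [hΛ, sampleLikelihoodRatio]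
    exact ENNReal.prod_ne_top fun i _ => ENNReal.ofReal_ne_top
  have hc0 : 0 ≤ c - 1 := by linarith
  have key : ∀ x, ENNReal.ofReal (4 * (c - 1)) * (h x * Λ x) + 2 * Λ x ≤
      ENNReal.ofReal (4 * (c - 1) * c) * h x + Λ x ^ 2 + 1 := by
    intro x
    obtain ⟨l, hl⟩ : ∃ l : ℝ, 0 ≤ l ∧ Λ x = ENNReal.ofReal l :=
      ⟨(Λ x).toReal, ENNReal.toReal_nonneg, (ENNReal.ofReal_toReal (hΛtop x)).symm⟩
    have hx1 : h x ≤ 1 := hg1 _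
    obtain ⟨t, ht⟩ : ∃ t : ℝ, 0 ≤ t ∧ h x = ENNReal.ofReal t :=
      ⟨(h x).toReal, ENNReal.toReal_nonneg,
        (ENNReal.ofReal_toReal (hx1.trans_lt ENNReal.one_lt_top).ne).symm⟩
    obtain ⟨hl0, hl⟩ := hl
    obtain ⟨ht0, ht⟩ := ht
    have ht1 : t ≤ 1 := by rwa [ht, ENNReal.ofReal_le_one] at hx1
    rw [hl, ht, ← ENNReal.ofReal_ofNat, ← ENNReal.ofReal_one, ← ENNReal.ofReal_pow hl0,
      ← ENNReal.ofReal_mul ht0, ← ENNReal.ofReal_mul (by positivity),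
      ← ENNReal.ofReal_mul (by positivity), ← ENNReal.ofReal_mul (by positivity),
      ← ENNReal.ofReal_add (by positivity) (by positivity),
      ← ENNReal.ofReal_add (by positivity) (by positivity),
      ← ENNReal.ofReal_add (by positivity) (by positivity)]
    refine ENNReal.ofReal_le_ofReal ?_
    -- The difference of the two sides is `t (l - 1 - 2 (c - 1))² + (1 - t) (l - 1)²`.
    nlinarith [mul_nonneg ht0 (sq_nonneg (l - 1 - 2 * (c - 1))),
      mul_nonneg (sub_nonneg.2 ht1) (sq_nonneg (l - 1))]
  have hint := lintegral_mono (μ := P) key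
  rw [lintegral_add_left (by fun_prop), lintegral_add_left (by fun_prop),
    lintegral_add_left (by fun_prop), lintegral_const_mul _ (by fun_prop),
    lintegral_const_mul _ (by fun_prop), lintegral_const_mul _ (by fun_prop), e2, ← e1, ← e0,
    lintegral_one, measure_univ] at hint
  have hfin : ∀ θ' : EuclideanSpace ℝ (Fin d), ∫⁻ x, g x ∂sampleLaw m θ' ≠ ∞ := fun θ' =>
    ((lintegral_mono hg1).trans_lt (by simp)).ne
  have hint2 := hint.trans (add_le_add_left (add_le_add_right e3 _) _)
  rw [← ENNReal.ofReal_toReal (hfin (θ + δ)), ← ENNReal.ofReal_toReal (hfin θ), mul_one] at hint2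
  generalize hA : (∫⁻ x, g x ∂sampleLaw m (θ + δ)).toReal = A at hint2 ⊢
  generalize hB : (∫⁻ x, g x ∂sampleLaw m θ).toReal = B at hint2 ⊢
  generalize hC : Real.exp (2 * m * ‖δ‖ ^ 2) = C at hint2 ⊢
  have hC0 : 0 ≤ C := hC ▸ (Real.exp_pos _).le
  have hA0 : 0 ≤ A := hA ▸ ENNReal.toReal_nonneg
  have hB0 : 0 ≤ B := hB ▸ ENNReal.toReal_nonneg
  rw [← ENNReal.ofReal_ofNat, ← ENNReal.ofReal_one,
    ← ENNReal.ofReal_mul (by positivity), ← ENNReal.ofReal_mul (by positivity),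
    ← ENNReal.ofReal_add (by positivity) (by positivity),
    ← ENNReal.ofReal_add (by positivity) (by positivity),
    ← ENNReal.ofReal_add (by positivity) (by positivity),
    ENNReal.ofReal_le_ofReal_iff (by positivity)] at hint2
  linarith

/-! ### A network that generates one-hot blocks -/

/-- The signal that carries the message `v`: block `i` has the coordinates `c i j`, and its only
nonzero entry is `z` at `c i (v i)`. The blocks are given by the embedding `c`, whose injectivity is
assumed separately where it matters. -/
noncomputable def blockSignal {k N d : ℕ} (c : Fin k → Fin N → Fin d) (z : ℝ)
    (v : Fin k → Fin N) : EuclideanSpace ℝ (Fin d) :=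
  ∑ i, EuclideanSpace.single (c i (v i)) z

/-- At the node `a + 1`, the tent function with nodes `j`, `j + 1`, `j + 2` (all scaled by `z`)
is `z` if `j = a` and `0` otherwise. -/
theorem hinge_second_difference {z : ℝ} (hz : 0 ≤ z) (a j : ℕ) :
    max ((a + 1) * z - j * z) 0 - 2 * max ((a + 1) * z - (j + 1) * z) 0
      + max ((a + 1) * z - (j + 2) * z) 0 = if j = a then z else 0 := by
  rcases lt_trichotomy j a with h | h | h
  · have h' : (j : ℝ) + 1 ≤ a := by exact_mod_cast h
    have h2 : 0 ≤ (a - (j + 1)) * z := mul_nonneg (by linarith) hz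
    rw [if_neg h.ne, max_eq_left (by nlinarith), max_eq_left (by nlinarith),
      max_eq_left (by nlinarith)]
    ring
  · subst h
    rw [if_pos rfl, max_eq_left (by nlinarith), max_eq_right (by nlinarith),
      max_eq_right (by nlinarith)]
    ring
  · have h' : (a : ℝ) + 1 ≤ j := by exact_mod_cast h
    have h2 : 0 ≤ (j - (a + 1)) * z := mul_nonneg (by linarith) hz
    rw [if_neg h.ne', max_eq_right (by nlinarith), max_eq_right (by nlinarith),
      max_eq_right (by nlinarith)]
    ring

/-- The range of some network contains the signals of all messages at all amplitudes. Each block of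
`N` outputs uses `N + 2` hinges in the first layer, whence the width condition. -/
theorem exists_reluNetwork_blockSignal_mem_range {k N d : ℕ} (h : k * (N + 2) ≤ d) :
    ∃ G : ReLUNetwork (k + 1) 3 d, G.WidthLE d ∧ ∃ c : Fin k → Fin N → Fin d,
      (∀ i j i' j', c i j = c i' j' → i = i' ∧ j = j') ∧
        ∀ z : ℝ, 0 ≤ z → ∀ v, blockSignal c z v ∈ Set.range G.eval := by
  have h' : k * N ≤ d := (Nat.mul_le_mul_left k (Nat.le_add_right N 2)).trans h
  let c : Fin k → Fin N → Fin d := fun i j => Fin.castLE h' (finProdFinEquiv (i, j))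
  let W₁ : Matrix (Fin (k * (N + 2))) (Fin (k + 1)) ℝ := fun r =>
    Pi.single (finProdFinEquiv.symm r).1.castSucc 1
      - Pi.single (Fin.last k) (((finProdFinEquiv.symm r).2 : ℕ) : ℝ)
  let W₂ : Matrix (Fin (k * N)) (Fin (k * (N + 2))) ℝ := fun r =>
    let p := finProdFinEquiv.symm r
    Pi.single (finProdFinEquiv (p.1, p.2.castAdd 2)) 1
      - Pi.single (finProdFinEquiv (p.1, p.2.succ.castSucc)) 2
      + Pi.single (finProdFinEquiv (p.1, p.2.succ.succ)) 1
  let W₃ : Matrix (Fin d) (Fin (k * N)) ℝ := fun s r => if Fin.castLE h' r = s then 1 else 0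
  refine ⟨.layer (.layer (.layer .input W₁) W₂) W₃, ⟨le_rfl, h', h, trivial⟩, c, ?_, ?_⟩
  · intro i j i' j' hij
    have := finProdFinEquiv.injective (Fin.castLE_injective h' hij)
    simpa using this
  · intro z hz v
    -- The last input is the bias `z`, and input `i` sits at the node of the message `v i`.
    let x : EuclideanSpace ℝ (Fin (k + 1)) :=
      WithLp.toLp 2 (Fin.snoc (fun i => ((v i : ℕ) + 1) * z) z)
    refine ⟨x, ?_⟩
    have e1 : ∀ i (j : Fin (N + 2)),
        ((ReLUNetwork.layer .input W₁).eval x) (finProdFinEquiv (i, j)) =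
          max (((v i : ℕ) + 1) * z - (j : ℕ) * z) 0 := by
      intro i j
      simp only [ReLUNetwork.eval, Matrix.mulVec, W₁, Equiv.symm_apply_apply, sub_dotProduct,
        single_dotProduct, x, Fin.snoc_castSucc, Fin.snoc_last, one_mul]
    have e2 : ∀ i (j : Fin N),
        ((ReLUNetwork.layer (.layer .input W₁) W₂).eval x) (finProdFinEquiv (i, j)) =
          if j = v i then z else 0 := by
      intro i j
      rw [ReLUNetwork.eval]
      simp only [Matrix.mulVec, W₂, Equiv.symm_apply_apply, add_dotProduct, sub_dotProduct,
        single_dotProduct, e1, one_mul]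
      have := hinge_second_difference hz (v i) j
      simp only [Fin.val_castAdd, Fin.val_castSucc, Fin.val_succ, Nat.cast_add, Nat.cast_one,
        Nat.cast_ofNat, add_assoc, one_add_one_eq_two] at this ⊢
      rw [this]
      simp only [Fin.ext_iff]
      split_ifs <;> simp [hz]
    ext s
    rw [ReLUNetwork.eval]
    have e3 : (W₃.mulVec ((ReLUNetwork.layer (.layer .input W₁) W₂).eval x).ofLp) s =
        blockSignal c z v s := by
      simp only [Matrix.mulVec, dotProduct, W₃]
      rw [← finProdFinEquiv.sum_comp, Fintype.sum_prod_type]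
      simp only [e2, blockSignal, WithLp.ofLp_sum, Finset.sum_apply, PiLp.single_apply]
      refine Finset.sum_congr rfl fun i _ => ?_
      simp [c, eq_comm]
    simp only [e3]
    refine max_eq_left ?_
    simp only [blockSignal, WithLp.ofLp_sum, Finset.sum_apply, PiLp.single_apply]
    exact Finset.sum_nonneg fun i _ => by split_ifs <;> simp [hz]

/-! ### Testing one block -/

/-- No randomized test (`g j` is the probability of the answer `j`) identifies the shift
among `N` candidates of length `z` with average success probability above `7 / 8`. -/
theorem sum_lintegral_sampleLaw_add_le {N d m : ℕ} (hN : 2 ≤ N) {z : ℝ} (hz : z ^ 2 ≤ 1 / 4)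
    (hmz : Real.exp (2 * m * z ^ 2) ≤ (3 * N + 4) / 8) (θ : EuclideanSpace ℝ (Fin d))
    {δ : Fin N → EuclideanSpace ℝ (Fin d)} (hδ : ∀ j, ‖δ j‖ ^ 2 = z ^ 2)
    {g : Fin N → (Fin m → EuclideanSpace ℝ (Fin d) × ℝ) → ℝ≥0∞} (hg : ∀ j, Measurable (g j))
    (hg1 : ∀ x, ∑ j, g j x ≤ 1) :
    ∑ j, (∫⁻ x, g j x ∂sampleLaw m (θ + δ j)).toReal ≤ 7 / 8 * N := by
  have hgj : ∀ j x, g j x ≤ 1 := fun j x =>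
    (Finset.single_le_sum (f := fun j => g j x) (fun _ _ => zero_le) (Finset.mem_univ j)).trans
      (hg1 x)
  have hN' : (2 : ℝ) ≤ N := by exact_mod_cast hN
  have h0 : ∑ j, (∫⁻ x, g j x ∂sampleLaw m θ).toReal ≤ 1 := by
    rw [← ENNReal.toReal_sum fun j _ => ((lintegral_mono (hgj j)).trans_lt (by simp)).ne,
      ← lintegral_finsetSum _ fun j _ => hg j]
    refine ENNReal.toReal_le_of_le_ofReal zero_le_one ?_
    exact (lintegral_mono hg1).trans_eq (by simp)
  have h1 := Finset.sum_le_sum fun j (_ : j ∈ Finset.univ) =>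
    lintegral_sampleLaw_add_le_lintegral_sampleLaw (m := m) (θ := θ) ((hδ j).trans_le hz) (hg j) (hgj j)
      (c := 3 * N / 4) (by linarith)
  simp only [Finset.sum_add_distrib, ← Finset.mul_sum, hδ, Finset.sum_const, Finset.card_univ,
    Fintype.card_fin, nsmul_eq_mul, mul_one] at h1
  set S := ∑ j, (∫⁻ x, g j x ∂sampleLaw m (θ + δ j)).toReal
  set B := ∑ j, (∫⁻ x, g j x ∂sampleLaw m θ).toReal
  have h3 : (0 : ℝ) < 3 * N - 4 := by linarith
  have h4 : (3 * N - 4) * (3 * N / 4) * B ≤ (3 * N - 4) * (3 * N / 4 : ℝ) * 1 :=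
    mul_le_mul_of_nonneg_left h0 (by positivity)
  have h5 : (N : ℝ) * Real.exp (2 * m * z ^ 2) ≤ N * ((3 * N + 4) / 8) :=
    mul_le_mul_of_nonneg_left hmz (by positivity)
  refine le_of_mul_le_mul_left ?_ h3
  linarith

/-- Redrawing one coordinate of a uniformly random function does not change its law. -/
theorem sum_sum_update {ι κ M : Type*} [Fintype ι] [DecidableEq ι] [Fintype κ]
    [AddCommMonoid M] (F : (ι → κ) → M) (i : ι) :
    ∑ v, ∑ j, F (Function.update v i j) = Fintype.card κ • ∑ v, F v := by
  let e : (ι → κ) × κ ≃ (ι → κ) × κ :=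
    Function.Involutive.toPerm (fun p => (Function.update p.1 i p.2, p.1 i)) fun p => by simp
  -- `(v, j) ↦ (v with j at place i, v i)` is an involution.
  calc ∑ v, ∑ j, F (Function.update v i j)
      = ∑ p : (ι → κ) × κ, F (Function.update p.1 i p.2) := by rw [Fintype.sum_prod_type]
    _ = ∑ p, F (e p).1 := rfl
    _ = ∑ p : (ι → κ) × κ, F p.1 := e.sum_comp fun p => F p.1
    _ = _ := by simp [Fintype.sum_prod_type, Finset.smul_sum]

/-- The estimates that are read as the letter `j` in block `i`: those within `z / 2` of the block
`z eⱼ`, in the supremum norm on the block. -/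
def blockRegion {k N d : ℕ} (c : Fin k → Fin N → Fin d) (z : ℝ) (i : Fin k) (j : Fin N) :
    Set (EuclideanSpace ℝ (Fin d)) :=
  {t | ∀ j', |t (c i j') - if j' = j then z else 0| < z / 2}

section blockRegion

variable {k N d : ℕ} {c : Fin k → Fin N → Fin d} {z : ℝ}

theorem measurableSet_blockRegion (i : Fin k) (j : Fin N) :
    MeasurableSet (blockRegion c z i j) := by
  simp only [blockRegion, Set.ofPred_forall]
  exact .iInter fun j' => measurableSet_lt (by fun_prop) measurable_const

theorem pairwise_disjoint_blockRegion (i : Fin k) :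
    Pairwise (Function.onFun Disjoint (blockRegion c z i)) := by
  intro j j' hjj
  refine Set.disjoint_left.2 fun t h1 h2 => ?_
  have h1 := abs_lt.1 (h1 j)
  have h2 := abs_lt.1 (h2 j)
  rw [if_pos rfl] at h1
  rw [if_neg hjj] at h2
  linarith

theorem blockSignal_apply (hc : ∀ i j i' j', c i j = c i' j' → i = i' ∧ j = j')
    (v : Fin k → Fin N) (i : Fin k) (j : Fin N) :
    blockSignal c z v (c i j) = if j = v i then z else 0 := by
  simp only [blockSignal, WithLp.ofLp_sum, Finset.sum_apply, PiLp.single_apply]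
  rw [Finset.sum_eq_single i]
  · by_cases h : j = v i
    · simp [h]
    · rw [if_neg h, if_neg fun h' => h (hc _ _ _ _ h').2]
  · exact fun i' _ h => if_neg fun h' => h (hc _ _ _ _ h').1.symm
  · simp

theorem norm_blockSignal_sq (hc : ∀ i j i' j', c i j = c i' j' → i = i' ∧ j = j')
    (v : Fin k → Fin N) : ‖blockSignal c z v‖ ^ 2 = k * z ^ 2 := by
  have h : inner ℝ (∑ i, EuclideanSpace.single (c i (v i)) z) (blockSignal c z v) =
      k * z ^ 2 := by
    rw [sum_inner]
    simp only [EuclideanSpace.inner_single_left, blockSignal_apply hc]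
    simp [sq]
  rw [← real_inner_self_eq_norm_sq, ← h, blockSignal]

theorem blockSignal_update (v : Fin k → Fin N) (i : Fin k) (j : Fin N) :
    blockSignal c z (Function.update v i j) =
      ∑ i' ∈ Finset.univ.erase i, EuclideanSpace.single (c i' (v i')) z +
        EuclideanSpace.single (c i j) z := by
  rw [blockSignal, ← Finset.sum_erase_add _ _ (Finset.mem_univ i), Function.update_self]
  congr 1
  exact Finset.sum_congr rfl fun i' hi' => by
    rw [Function.update_of_ne (Finset.ne_of_mem_erase hi')]

/-- The estimation error is at least `z / (2 √k)` times the number `w` of misread blocks. Each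
misread block contributes `(z / 2)²` to the squared error, and `√w ≥ w / √k` since `w ≤ k`. -/
theorem sum_indicator_blockRegion_le_norm (hk : 0 < k) (hz : 0 ≤ z)
    (hc : ∀ i j i' j', c i j = c i' j' → i = i' ∧ j = j')
    (v : Fin k → Fin N) (t : EuclideanSpace ℝ (Fin d)) :
    z / (2 * √k) * ∑ i, (blockRegion c z i (v i))ᶜ.indicator 1 t ≤ ‖t - blockSignal c z v‖ := by
  classical
  set θ := blockSignal c z v with hθ
  set E := Finset.univ.filter fun i => t ∉ blockRegion c z i (v i) with hE
  have hsum : ∑ i, (blockRegion c z i (v i))ᶜ.indicator (1 : EuclideanSpace ℝ (Fin d) → ℝ) t =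
      E.card := by
    rw [hE, ← Finset.sum_boole]
    exact Finset.sum_congr rfl fun i _ => by simp [Set.indicator_apply]
  have hex : ∀ i, ∃ j, i ∈ E → z / 2 ≤ |t (c i j) - θ (c i j)| := by
    intro i
    by_cases hi : i ∈ E
    · simp only [hE, Finset.mem_filter, blockRegion, Set.mem_ofPred_eq, not_forall, not_lt] at hi
      obtain ⟨-, j, hj⟩ := hi
      exact ⟨j, fun _ => by rwa [hθ, blockSignal_apply hc]⟩
    · exact ⟨v i, fun h => absurd h hi⟩
  choose w hw using hex
  have hinj : Set.InjOn (fun i => c i (w i)) E := fun i _ i' _ h => (hc _ _ _ _ h).1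
  have h1 : E.card * (z / 2) ^ 2 ≤ ‖t - θ‖ ^ 2 := by
    rw [EuclideanSpace.real_norm_sq_eq]
    calc E.card * (z / 2) ^ 2 = ∑ i ∈ E, (z / 2) ^ 2 := by simp
      _ ≤ ∑ i ∈ E, (t - θ) (c i (w i)) ^ 2 := Finset.sum_le_sum fun i hi => by
          rw [← sq_abs ((t - θ) _)]
          exact pow_le_pow_left₀ (by positivity) (hw i hi) 2
      _ = ∑ s ∈ E.image fun i => c i (w i), (t - θ) s ^ 2 :=
          (Finset.sum_image (f := fun s => (t - θ) s ^ 2) hinj).symm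
      _ ≤ ∑ s, (t - θ) s ^ 2 :=
          Finset.sum_le_sum_of_subset_of_nonneg (Finset.subset_univ _) fun _ _ _ => sq_nonneg _
  rw [hsum]
  refine abs_le_of_sq_le_sq' ?_ (norm_nonneg _) |>.2
  refine le_trans ?_ h1
  have hEk : (E.card : ℝ) ≤ k := by
    exact_mod_cast (Finset.card_le_univ E).trans_eq (Fintype.card_fin k)
  have hk' : (0 : ℝ) < k := by exact_mod_cast hk
  rw [mul_pow, div_pow, mul_pow, Real.sq_sqrt hk'.le]
  calc z ^ 2 / (2 ^ 2 * k) * (E.card : ℝ) ^ 2 = E.card * (z / 2) ^ 2 * (E.card / k) := by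
        field_simp
    _ ≤ E.card * (z / 2) ^ 2 * 1 :=
        mul_le_mul_of_nonneg_left ((div_le_one hk').2 hEk) (by positivity)
    _ = _ := mul_one _

end blockRegion

/-! ### The minimax lower bound -/

/-- The risk of any estimator at the worst signal is at least its average over all messages, for
which every block is misread with probability at least `1 / 8`. -/
theorem ofReal_le_linearMinimaxRisk {k N d m : ℕ} (hk : 0 < k) (hN : 2 ≤ N)
    {c : Fin k → Fin N → Fin d} (hc : ∀ i j i' j', c i j = c i' j' → i = i' ∧ j = j')
    {z : ℝ} (hz : 0 ≤ z) (hz4 : z ^ 2 ≤ 1 / 4)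
    (hmz : Real.exp (2 * m * z ^ 2) ≤ (3 * N + 4) / 8)
    {K : Set (EuclideanSpace ℝ (Fin d))} (hK : ∀ v, blockSignal c z v ∈ K) :
    ENNReal.ofReal (z * √k / 16) ≤ linearMinimaxRisk m K := by
  rw [linearMinimaxRisk, minimaxRisk]
  refine le_iInf₂ fun η hη => ?_
  set R := ⨆ θ : K, ∫⁻ t, ENNReal.ofReal ‖t - (θ : EuclideanSpace ℝ (Fin d))‖
    ∂((η ∘ₖ sampleKernel m K) θ)
  rcases eq_or_ne R ∞ with hRtop | hRtop
  · rw [hRtop]; exact le_top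
  have : IsMarkovKernel (sampleKernel m K) :=
    ⟨fun θ => inferInstanceAs (IsProbabilityMeasure (sampleLaw m _))⟩
  let μ : (Fin k → Fin N) → Measure (EuclideanSpace ℝ (Fin d)) := fun v =>
    (η ∘ₖ sampleKernel m K) ⟨blockSignal c z v, hK v⟩
  have hμ : ∀ v, IsProbabilityMeasure (μ v) := fun v =>
    inferInstanceAs (IsProbabilityMeasure ((η ∘ₖ sampleKernel m K) _))
  have hμs : ∀ v s, MeasurableSet s →
      μ v s = ∫⁻ x, η x s ∂sampleLaw m (blockSignal c z v) := fun v s hs =>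
    Kernel.comp_apply' _ _ _ hs
  have hA := fun i j => measurableSet_blockRegion (c := c) (z := z) i j
  have hk' : (0 : ℝ) < k := by exact_mod_cast hk
  have hN' : (0 : ℝ) < N := by positivity
  set p : Fin k → (Fin k → Fin N) → ℝ := fun i v => (μ v).real (blockRegion c z i (v i)) with hp
  -- The average over `v` is taken first over `v i`, the other letters being fixed.
  have hsucc : ∀ i, ∑ v, p i v ≤ 7 / 8 * (N : ℝ) ^ k := by
    intro i
    have hupd : ∀ v : Fin k → Fin N, ∑ j, p i (Function.update v i j) ≤ 7 / 8 * N := by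
      intro v
      have h := sum_lintegral_sampleLaw_add_le (m := m) hN hz4 hmz
        (∑ i' ∈ Finset.univ.erase i, EuclideanSpace.single (c i' (v i')) z)
        (δ := fun j => EuclideanSpace.single (c i j) z) (fun j => by simp)
        (g := fun j x => η x (blockRegion c z i j))
        (fun j => η.measurable_coe (hA i j)) (fun x => by
          rw [← tsum_fintype (L := .unconditional _), ← measure_iUnion
            (pairwise_disjoint_blockRegion i) (hA i)]
          exact prob_le_one)
      refine le_of_eq_of_le (Finset.sum_congr rfl fun j _ => ?_) h
      simp only [hp, Measure.real, Function.update_self]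
      rw [hμs _ _ (hA i j), blockSignal_update]
    have hsum := Finset.sum_le_sum fun v (_ : v ∈ Finset.univ) => hupd v
    rw [sum_sum_update] at hsum
    simp only [Finset.sum_const, Finset.card_univ, Fintype.card_fun, Fintype.card_fin,
      nsmul_eq_mul, Nat.cast_pow] at hsum
    refine le_of_mul_le_mul_left (hsum.trans_eq ?_) hN'
    ring
  have hrisk : ∀ v, z / (2 * √k) * ∑ i, (1 - p i v) ≤ R.toReal := by
    intro v
    have h1 : ∫⁻ t, ENNReal.ofReal ‖t - blockSignal c z v‖ ∂μ v ≤ R :=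
      le_iSup (fun θ : K => ∫⁻ t, ENNReal.ofReal ‖t - (θ : EuclideanSpace ℝ (Fin d))‖
        ∂((η ∘ₖ sampleKernel m K) θ)) ⟨blockSignal c z v, hK v⟩
    have hint : ∀ i, Integrable
        ((blockRegion c z i (v i))ᶜ.indicator (1 : EuclideanSpace ℝ (Fin d) → ℝ)) (μ v) :=
      fun i => (integrable_const 1).indicator (hA i _).compl
    have h2 : z / (2 * √k) * ∑ i, (1 - p i v) =
        ∫ t, z / (2 * √k) * ∑ i, (blockRegion c z i (v i))ᶜ.indicator 1 t ∂μ v := by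
      rw [integral_const_mul, integral_finsetSum _ fun i _ => hint i]
      congr 1
      refine Finset.sum_congr rfl fun i _ => ?_
      rw [integral_indicator_one (hA i _).compl, probReal_compl_eq_one_sub (hA i _)]
    rw [h2, ← ENNReal.ofReal_le_iff_le_toReal hRtop]
    rw [ofReal_integral_eq_lintegral_ofReal ((integrable_finsetSum _ fun i _ => hint i).const_mul _)
      (.of_forall fun t => mul_nonneg (by positivity) (Finset.sum_nonneg fun i _ =>
        Set.indicator_nonneg (fun _ _ => zero_le_one) _))]
    exact (lintegral_mono fun t => ENNReal.ofReal_le_ofReal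
      (sum_indicator_blockRegion_le_norm hk hz hc v t)).trans h1
  rw [ENNReal.ofReal_le_iff_le_toReal hRtop]
  have hM : (0 : ℝ) < (N : ℝ) ^ k := by positivity
  have htot := Finset.sum_le_sum fun v (_ : v ∈ Finset.univ) => hrisk v
  rw [← Finset.mul_sum, Finset.sum_comm] at htot
  simp only [Finset.sum_sub_distrib, Finset.sum_const, Finset.card_univ, Fintype.card_fun,
    Fintype.card_fin, nsmul_eq_mul, Nat.cast_pow, mul_one] at htot
  have herr : (k : ℝ) * ((N : ℝ) ^ k / 8) ≤ k * (N : ℝ) ^ k - ∑ i, ∑ v, p i v := by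
    have := Finset.sum_le_sum fun i (_ : i ∈ Finset.univ) => hsucc i
    simp only [Finset.sum_const, Finset.card_univ, Fintype.card_fin, nsmul_eq_mul] at this
    linarith
  refine le_of_mul_le_mul_left (le_trans ?_ htot) hM
  refine le_trans (le_of_eq ?_) (mul_le_mul_of_nonneg_left herr (by positivity))
  have hs : √(k : ℝ) ≠ 0 := (Real.sqrt_pos.2 hk').ne'
  have hs2 : (k : ℝ) = √k * √k := (Real.mul_self_sqrt hk'.le).symm
  generalize √(k : ℝ) = s at hs hs2 ⊢
  rw [hs2]
  field_simp
  ring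

/-- Bernoulli's inequality for the fourth power of `N ^ (1 / 4)`. -/
theorem exp_log_div_four_le {N : ℕ} (hN : 2 ≤ N) :
    Real.exp (Real.log N / 4) ≤ (3 * N + 4) / 8 := by
  have hN' : (2 : ℝ) ≤ N := by exact_mod_cast hN
  have h : Real.exp (Real.log N / 4) ^ 4 = N := by
    rw [← Real.exp_nat_mul, Nat.cast_ofNat, mul_div_cancel₀ _ (by norm_num),
      Real.exp_log (by linarith)]
  have hb := one_add_mul_le_pow (a := Real.exp (Real.log N / 4) - 1)
    (by linarith [Real.exp_pos (Real.log N / 4)]) 4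
  rw [add_sub_cancel, h] at hb
  push_cast at hb
  linarith

theorem theorem2 :
    ∃ c₁ c₂ : ℝ, 0 < c₁ ∧ 0 < c₂ ∧
      ∀ k d : ℕ, 0 < k → (k : ℝ) ≤ (d : ℝ) / 4 →
        ∃ G : ReLUNetwork (k + 1) 3 d, G.WidthLE d ∧
          ∀ m : ℕ, c₁ * ((k : ℝ) * Real.log ((d : ℝ) / (k : ℝ))) ≤ (m : ℝ) →
            ENNReal.ofReal
                (c₂ * Real.sqrt ((k : ℝ) * Real.log ((d : ℝ) / (k : ℝ)) / (m : ℝ))) ≤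
              linearMinimaxRisk m G.unitBallRange := by
  refine ⟨1, 1 / 80, one_pos, by norm_num, fun k d hk hkd => ?_⟩
  have hk' : (0 : ℝ) < k := by exact_mod_cast hk
  have hk1 : (1 : ℝ) ≤ k := by exact_mod_cast hk
  have hkd' : 4 * k ≤ d := by
    have : (4 : ℝ) * k ≤ d := by linarith
    exact_mod_cast this
  have hq : 4 ≤ d / k := (Nat.le_div_iff_mul_le hk).2 hkd'
  obtain ⟨N, hNq⟩ : ∃ N, d / k = N + 2 := ⟨d / k - 2, by omega⟩
  have hN : 2 ≤ N := by omega
  have hN' : (2 : ℝ) ≤ N := by exact_mod_cast hN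
  have hkN : k * (N + 2) ≤ d := hNq ▸ Nat.mul_div_le d k
  obtain ⟨G, hG, c, hc, hrange⟩ := exists_reluNetwork_blockSignal_mem_range hkN
  refine ⟨G, hG, fun m hm => ?_⟩
  set ρ : ℝ := d / k with hρ
  have hNρ : (N : ℝ) ≤ ρ := by
    rw [hρ, le_div_iff₀ hk']
    have : ((k * (N + 2) : ℕ) : ℝ) ≤ d := by exact_mod_cast hkN
    push_cast at this
    nlinarith
  -- The cube is needed only for small `N`: at `N = 2` the ratio `ρ` may be close to `5`.
  have hρN : ρ ≤ (N : ℝ) ^ 3 := by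
    have h1 : d < (N + 3) * k := by
      have := Nat.lt_succ_of_le hNq.le
      rwa [Nat.div_lt_iff_lt_mul hk] at this
    have h2 : (d : ℝ) < (N + 3) * k := by exact_mod_cast h1
    have h3 : ρ < N + 3 := (div_lt_iff₀ hk').2 h2
    nlinarith [mul_nonneg (sub_nonneg.2 hN') (sub_nonneg.2 hN')]
  have hlogN : 0 < Real.log N := Real.log_pos (by linarith)
  have hlog1 : Real.log N ≤ Real.log ρ := Real.log_le_log (by linarith) hNρ
  have hlog2 : Real.log ρ ≤ 3 * Real.log N := by
    have := Real.log_le_log (by linarith) hρN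
    rwa [Real.log_pow, Nat.cast_ofNat] at this
  have hkm : k * Real.log N ≤ m := by
    rw [one_mul] at hm
    exact (mul_le_mul_of_nonneg_left hlog1 hk'.le).trans hm
  have hm0 : (0 : ℝ) < m := (mul_pos hk' hlogN).trans_le hkm
  set z : ℝ := √(Real.log N / (8 * m)) with hz
  have hz2 : z ^ 2 = Real.log N / (8 * m) := Real.sq_sqrt (by positivity)
  have hz0 : 0 ≤ z := Real.sqrt_nonneg _
  have hkz : k * z ^ 2 ≤ 1 / 8 := by
    rw [hz2, ← mul_div_assoc, div_le_iff₀ (by positivity)]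
    linarith
  have hz4 : z ^ 2 ≤ 1 / 4 := by nlinarith [sq_nonneg z]
  have hmz : Real.exp (2 * m * z ^ 2) ≤ (3 * N + 4) / 8 := by
    rw [hz2, show 2 * m * (Real.log N / (8 * m)) = Real.log N / 4 by field_simp; norm_num]
    exact exp_log_div_four_le hN
  refine le_trans (ENNReal.ofReal_le_ofReal ?_)
    (ofReal_le_linearMinimaxRisk hk hN hc hz0 hz4 hmz fun v =>
      ⟨hrange z hz0 v, ?_⟩)
  · -- After squaring, the claim is `3 / 80² ≤ 1 / 2048`.
    refine abs_le_of_sq_le_sq' ?_ (by positivity) |>.2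
    rw [mul_pow, div_pow, div_pow, mul_pow, Real.sq_sqrt hk'.le, hz2,
      Real.sq_sqrt (div_nonneg (mul_nonneg hk'.le (hlogN.le.trans hlog1)) hm0.le)]
    have h1 : k * Real.log ρ / m ≤ 3 * (k * Real.log N / m) := by
      rw [← mul_div_assoc]
      refine div_le_div_of_nonneg_right ?_ hm0.le
      nlinarith
    have h2 : Real.log N / (8 * m) * k / 16 ^ 2 = 1 / 2048 * (k * Real.log N / m) := by
      field_simp; norm_num
    have h3 : 0 ≤ k * Real.log N / m := by positivity
    rw [h2]
    linarith
  · rw [mem_closedBall_zero_iff]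
    refine abs_le_of_sq_le_sq' ?_ zero_le_one |>.2
    rw [norm_blockSignal_sq hc]
    linarith
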